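/- Let $T>0$ and $d\in\mathbb N$, let $|\cdot|$ be the Euclidean norm on $\mathbb R^d$, and let $\mathrm{dist}_H$ be the Hausdorff distance between nonempty compact subsets of $\mathbb R^d$. Let $f:[0,T]\times\mathbb R^d\to\mathbb R^d$ be continuous, and let $l_f:[0,T]\to\mathbb R$ be a continuous function such that $$\langle f(t,x)-f(t,x'),x-x'\rangle\le l_f(t)|x-x'|^2\qquad\text{for all }t\in[0,T],\ x,x'\in\mathbb R^d.$$ Let $M$ be a map from $[0,T]\times\mathbb R^d$ to the nonempty convex compact subsets of $\mathbb R^d$ that is continuous with respect to the Hausdorff metric, and let $L_M:[0,T]\to[0,\infty)$ be a continuous function such that $$\mathrm{dist}_H(M(t,x),M(t,x'))\le L_M(t)|x-x'|\qquad\text{for all }t\in[0,T],\ x,x'\in\mathbb R^d.$$ Put $$D:=\{(t,x,h)\in[0,T]\times\mathbb R^d\times[0,\infty):\ t+h\le T,\ l_f(t+h)h<1\}$$ and, for $(t,x,h)\in D$, $$\Phi(t,x;h):=\{z\in\mathbb R^d:\ z\in x+hf(t+h,z)+hM(t,x)\}.$$ Then the sets $\Phi(t,x;h)$, $(t,x,h)\in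 D$, are nonempty and compact, and the following hold. 1. The set-valued map $(t,x,h)\mapsto\Phi(t,x;h)$ is jointly continuous on $D$ with respect to the Hausdorff metric. 2. For all $t,h,x,x'$ with $(t,x,h),(t,x',h)\in D$, $$\mathrm{dist}_H(\Phi(t,x;h),\Phi(t,x';h))\le\frac{1+hL_M(t)}{1-l_f(t+h)h}\,|x-x'|.$$ 3. $\Phi(t,x;0)=\{x\}$ for all $t\in[0,T]$ and $x\in\mathbb R^d$. -/

import Mathlib

open Set Filter Topology

/-- A set-valued map `G : X → Set E` is continuous on `S` with respect to the Hausdorff metric: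
its values on `S` are nonempty and compact (so that the Hausdorff distance between them is the
genuine, finite one), and `q → p` within `S` implies that the Hausdorff distance between
`G q` and `G p` tends to `0`, for every `p ∈ S`. -/
def HausdorffContinuousOn {X E : Type*} [TopologicalSpace X] [MetricSpace E]
    (G : X → Set E) (S : Set X) : Prop :=
  (∀ p ∈ S, (G p).Nonempty ∧ IsCompact (G p)) ∧
    ∀ p ∈ S, Tendsto (fun q => Metric.hausdorffDist (G q) (G p)) (𝓝[S] p) (𝓝 0)

/-- The domain `D` of the semi-implicit Euler scheme: all `(t, x, h)` with `t ∈ [0,T]`, `h ≥ 0`,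
`t + h ∈ [0,T]` (so that `l_f (t + h)` and `f (t + h) z` are meaningful) and
`l_f (t + h) * h < 1`. -/
def eulerDomain {d : ℕ} (T : ℝ) (lf : ℝ → ℝ) : Set (ℝ × EuclideanSpace ℝ (Fin d) × ℝ) :=
  {p | p.1 ∈ Icc 0 T ∧ 0 ≤ p.2.2 ∧ p.1 + p.2.2 ≤ T ∧ lf (p.1 + p.2.2) * p.2.2 < 1}

/-- One step of the parameterized semi-implicit Euler scheme,
`Φ(t, x; h) = {z | z ∈ x + h f(t + h, z) + h M(t, x)}`. -/
def eulerStep {d : ℕ} (f : ℝ → EuclideanSpace ℝ (Fin d) → EuclideanSpace ℝ (Fin d))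
    (M : ℝ → EuclideanSpace ℝ (Fin d) → Set (EuclideanSpace ℝ (Fin d)))
    (t : ℝ) (x : EuclideanSpace ℝ (Fin d)) (h : ℝ) : Set (EuclideanSpace ℝ (Fin d)) :=
  {z | ∃ m ∈ M t x, z = x + h • f (t + h) z + h • m}

/-! Put `g z = z - h • f (t + h) z`. The one-sided Lipschitz bound makes `g` strongly monotone with
constant `c = 1 - lf (t + h) * h`, positive on the domain, and one Euler step is the preimage under
`g` of the compact set `x + h M(t, x)`. A continuous strongly monotone map of a finite-dimensional
space is onto (`surjective_of_strongly_monotone`) and expands distances by `c`, so these preimages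
are nonempty and compact. Both estimates come from `hausdorffDist_preimage_le`: a change of the
target set or of the map moves the preimage by at most the change divided by `c`. For fixed `t` and
`h` only the target moves, by at most `(1 + h * LM t) * ‖x - x'‖`. For joint continuity the map
moves too, but its change is needed only on the compact limit value, where it is uniformly small.
Surjectivity is Minty's argument: Sion's minimax theorem solves finitely many variational
inequalities, compactness solves all of them, and on a large ball the solution is interior. -/

section MonotoneOperators

/-! ### Variational inequalities for monotone maps -/

variable {E : Type*} [NormedAddCommGroup E] [InnerProductSpace ℝ E]

/-- Finitely many of the variational inequalities of a monotone map on a compact convex set have a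
common solution. -/
theorem exists_forall_finset_inner_nonneg_of_monotone {K : Set E} (hK : IsCompact K)
    (hKc : Convex ℝ K) (hKne : K.Nonempty) {g : E → E}
    (hg : ∀ x y, 0 ≤ inner ℝ (g x - g y) (x - y)) (u : Finset K) :
    ∃ z ∈ K, ∀ y ∈ u, 0 ≤ inner ℝ (g y) ((y : E) - z) := by
  classical
  rcases u.eq_empty_or_nonempty with rfl | hu
  · obtain ⟨z, hz⟩ := hKne
    exact ⟨z, hz, by simp⟩
  -- Affine in `z` and linear in the weights `b`, so a saddle point exists on `K` times the simplex;
  -- its `z`-component is the common solution.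
  let F : E → (u → ℝ) → ℝ := fun z b => ∑ i, b i * inner ℝ (g i) (z - (i : E))
  have : Nonempty u := hu.to_subtype
  have hlin : ∀ b : u → ℝ, ∀ z z' : E, ∀ s t : ℝ, s + t = 1 →
      F (s • z + t • z') b = s * F z b + t * F z' b := by
    intro b z z' s t hst
    simp only [F, Finset.mul_sum, ← Finset.sum_add_distrib]
    refine Finset.sum_congr rfl fun i _ => ?_
    simp only [inner_sub_right, inner_add_right, inner_smul_right]
    linear_combination (b i * inner ℝ (g i) ((i : K) : E)) * hst
  have hlin' : ∀ z : E, ∀ b b' : u → ℝ, ∀ s t : ℝ,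
      F z (s • b + t • b') = s * F z b + t * F z b' := by
    intro z b b' s t
    simp only [F, Finset.mul_sum, ← Finset.sum_add_distrib]
    refine Finset.sum_congr rfl fun i _ => ?_
    simp only [Pi.add_apply, Pi.smul_apply, smul_eq_mul]
    ring
  obtain ⟨a, ha, b, hb, hab⟩ := Sion.exists_isSaddlePointOn' (X := K) (Y := stdSimplex ℝ u)
    (f := F) hKne hK
    (fun b _ => ContinuousOn.lowerSemicontinuousOn (by fun_prop))
    (fun b _ => ConvexOn.quasiconvexOn
      ⟨hKc, fun x _ y _ s t _ _ hst => (hlin b x y s t hst).le⟩)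
    (convex_stdSimplex ℝ u) (isCompact_stdSimplex ℝ u)
    (fun z _ => ContinuousOn.upperSemicontinuousOn (by fun_prop))
    (fun z _ => ConcaveOn.quasiconcaveOn
      ⟨convex_stdSimplex ℝ u, fun x _ y _ s t _ _ _ => (hlin' z x y s t).ge⟩)
    hKc ⟨_, single_mem_stdSimplex ℝ hu.to_subtype.some⟩
  refine ⟨a, ha, fun y hy => ?_⟩
  -- At the barycentre for the optimal weights, monotonicity replaces each `g i` by `g x`, and the
  -- weighted sum of `x - i` vanishes; hence the saddle value is at most `0`.
  set x : E := ∑ i : u, b i • ((i : K) : E) with hx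
  have hxK : x ∈ K := hKc.sum_mem (fun i _ => hb.1 i) hb.2 fun i _ => i.1.2
  have h1 := hab x hxK (Pi.single ⟨y, hy⟩ 1) (single_mem_stdSimplex ℝ _)
  have h2 : F x b ≤ 0 := by
    calc F x b ≤ ∑ i, b i * inner ℝ (g x) (x - ((i : K) : E)) := by
          refine Finset.sum_le_sum fun i _ => mul_le_mul_of_nonneg_left ?_ (hb.1 i)
          have := hg x ((i : K) : E)
          rw [inner_sub_left] at this
          linarith
      _ = inner ℝ (g x) (∑ i, b i • (x - ((i : K) : E))) := by
          simp [inner_sum, inner_smul_right]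
      _ = 0 := by
          simp only [smul_sub, Finset.sum_sub_distrib, ← Finset.sum_smul, hb.2, one_smul]
          rw [← hx, sub_self, inner_zero_right]
  have h3 : F a (Pi.single ⟨y, hy⟩ 1) = inner ℝ (g y) (a - (y : E)) := by
    simp only [F]
    rw [Finset.sum_eq_single ⟨y, hy⟩]
    · simp
    · intro j _ hj
      simp [Pi.single_eq_of_ne hj]
    · simp
  rw [h3] at h1
  rw [← neg_sub, inner_neg_right]
  linarith

/-- The Stampacchia variational inequality for a continuous monotone map on a compact convex set
has a solution (Minty). -/
theorem exists_forall_inner_nonneg_of_monotone {K : Set E} (hK : IsCompact K)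
    (hKc : Convex ℝ K) (hKne : K.Nonempty) {g : E → E} (hgc : Continuous g)
    (hg : ∀ x y, 0 ≤ inner ℝ (g x - g y) (x - y)) :
    ∃ z ∈ K, ∀ y ∈ K, 0 ≤ inner ℝ (g z) (y - z) := by
  -- With `g` evaluated at `y` instead of `z`, each inequality is a closed condition on `z`, so
  -- finite intersections suffice.
  obtain ⟨z, hzK, hz⟩ := hK.inter_iInter_nonempty
    (fun y : K => {z : E | 0 ≤ inner ℝ (g y) ((y : E) - z)})
    (fun y => isClosed_le continuous_const (by fun_prop))
    (fun u => by
      obtain ⟨z, hz, h⟩ := exists_forall_finset_inner_nonneg_of_monotone hK hKc hKne hg u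
      exact ⟨z, hz, by simpa using fun y hy hyu => h ⟨y, hy⟩ hyu⟩)
  have hz' : ∀ y ∈ K, 0 ≤ inner ℝ (g y) (y - z) := fun y hy => mem_iInter.1 hz ⟨y, hy⟩
  refine ⟨z, hzK, fun y hy => ?_⟩
  -- Minty's trick: test at a point of the segment from `z` to `y`, divide by `s`, and let `s → 0`
  -- to move the argument of `g` to `z`.
  have hpos : ∀ s ∈ Ioc (0 : ℝ) 1, 0 ≤ inner ℝ (g (z + s • (y - z))) (y - z) := by
    intro s hs
    have h := hz' _ (hKc.add_smul_sub_mem hzK hy ⟨hs.1.le, hs.2⟩)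
    rw [add_sub_cancel_left, inner_smul_right] at h
    exact nonneg_of_mul_nonneg_right h hs.1
  have hlim : Tendsto (fun s : ℝ => inner ℝ (g (z + s • (y - z))) (y - z)) (𝓝[>] 0)
      (𝓝 (inner ℝ (g z) (y - z))) := by
    have hc : Continuous fun s : ℝ => inner ℝ (g (z + s • (y - z))) (y - z) := by fun_prop
    simpa using (hc.tendsto 0).mono_left nhdsWithin_le_nhds
  exact ge_of_tendsto hlim (by
    filter_upwards [Ioc_mem_nhdsGT (zero_lt_one' ℝ)] with s hs using hpos s hs)

/-! ### Strongly monotone maps and their preimages -/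

/-- A strongly monotone map expands distances by its monotonicity constant. -/
theorem mul_norm_sub_le_of_strongly_monotone {g : E → E} {c : ℝ}
    (hg : ∀ x y, c * ‖x - y‖ ^ 2 ≤ inner ℝ (g x - g y) (x - y)) (x y : E) :
    c * ‖x - y‖ ≤ ‖g x - g y‖ := by
  rcases (norm_nonneg (x - y)).eq_or_lt with h | h
  · simp [← h]
  · refine le_of_mul_le_mul_right ?_ h
    calc c * ‖x - y‖ * ‖x - y‖ = c * ‖x - y‖ ^ 2 := by ring
      _ ≤ _ := hg x y
      _ ≤ _ := real_inner_le_norm _ _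

/-- A continuous strongly monotone map of a finite-dimensional space is surjective. -/
theorem surjective_of_strongly_monotone [FiniteDimensional ℝ E] {g : E → E} {c : ℝ} (hc : 0 < c)
    (hgc : Continuous g) (hg : ∀ x y, c * ‖x - y‖ ^ 2 ≤ inner ℝ (g x - g y) (x - y)) :
    Function.Surjective g := by
  intro w
  have : ProperSpace E := FiniteDimensional.proper ℝ E
  -- Testing with `0` bounds any solution by `‖w - g 0‖ / c`; the extra `1` keeps it off the
  -- boundary.
  set R : ℝ := ‖w - g 0‖ / c + 1 with hR
  have hR0 : 0 < R := by positivity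
  obtain ⟨z, hz, hzv⟩ := exists_forall_inner_nonneg_of_monotone
    (isCompact_closedBall (0 : E) R) (convex_closedBall 0 R) ⟨0, by simp [hR0.le]⟩
    (g := fun y => g y - w) (by fun_prop) (fun x y => by
      simpa using (by positivity : 0 ≤ c * ‖x - y‖ ^ 2).trans (hg x y))
  have hzR : ‖z‖ < R := by
    have h0 := hzv 0 (by simp [hR0.le])
    have h1 := hg z 0
    have h2 := real_inner_le_norm (w - g 0) z
    simp only [sub_zero, zero_sub, inner_neg_right, inner_sub_left] at h0 h1
    rw [inner_sub_left] at h2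
    have h3 : c * ‖z‖ ^ 2 ≤ ‖w - g 0‖ * ‖z‖ := by linarith
    have h4 : ‖z‖ ≤ ‖w - g 0‖ / c := by
      rw [le_div_iff₀ hc]
      rcases (norm_nonneg z).eq_or_lt with h | h
      · simp [← h]
      · exact le_of_mul_le_mul_right (by linarith) h
    linarith
  refine ⟨z, ?_⟩
  by_contra hne
  have hv : 0 < ‖g z - w‖ := norm_pos_iff.2 (sub_ne_zero.2 hne)
  -- The longest step against `g z - w` whose endpoint is sure to stay in the ball; testing there
  -- gives `0 ≤ -s * ‖g z - w‖ ^ 2`.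
  set s : ℝ := (R - ‖z‖) / ‖g z - w‖ with hs
  have hs0 : 0 < s := div_pos (by linarith) hv
  have h := hzv (z - s • (g z - w)) (by
    rw [mem_closedBall_zero_iff]
    calc _ ≤ ‖z‖ + ‖s • (g z - w)‖ := norm_sub_le _ _
      _ = R := by rw [norm_smul, Real.norm_of_nonneg hs0.le, hs, div_mul_cancel₀ _ hv.ne']; ring)
  rw [sub_sub_cancel_left, inner_neg_right, inner_smul_right, real_inner_self_eq_norm_sq] at h
  have : 0 < s * ‖g z - w‖ ^ 2 := by positivity
  linarith

/-- Hausdorff distance between the preimages of two sets under two maps, one of them strongly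
monotone. -/
theorem hausdorffDist_preimage_le {g g₀ : E → E} {c δ ε : ℝ} (hc : 0 < c)
    (hg : ∀ x y, c * ‖x - y‖ ^ 2 ≤ inner ℝ (g x - g y) (x - y))
    (hgs : Function.Surjective g) (hg₀s : Function.Surjective g₀) {A A₀ : Set E}
    (hδ : 0 ≤ δ) (hε : 0 ≤ ε)
    (hA : ∀ a ∈ A, ∃ b ∈ A₀, ‖a - b‖ ≤ δ) (hA₀ : ∀ b ∈ A₀, ∃ a ∈ A, ‖a - b‖ ≤ δ)
    (hgg₀ : ∀ z ∈ g₀ ⁻¹' A₀, ‖g z - g₀ z‖ ≤ ε) :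
    Metric.hausdorffDist (g ⁻¹' A) (g₀ ⁻¹' A₀) ≤ (δ + ε) / c := by
  -- Only `g` has to expand distances, and `g - g₀` is evaluated only at `z₀ ∈ g₀ ⁻¹' A₀`.
  have key : ∀ z z₀, g₀ z₀ ∈ A₀ → ‖g z - g₀ z₀‖ ≤ δ → dist z z₀ ≤ (δ + ε) / c := by
    intro z z₀ hz₀ h
    rw [le_div_iff₀ hc, dist_eq_norm, mul_comm]
    refine (mul_norm_sub_le_of_strongly_monotone hg z z₀).trans ?_
    calc ‖g z - g z₀‖ = ‖(g z - g₀ z₀) - (g z₀ - g₀ z₀)‖ := by rw [sub_sub_sub_cancel_right]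
      _ ≤ _ := norm_sub_le _ _
      _ ≤ δ + ε := add_le_add h (hgg₀ _ hz₀)
  refine Metric.hausdorffDist_le_of_mem_dist (by positivity) ?_ ?_
  · intro z hz
    obtain ⟨b, hb, hab⟩ := hA _ hz
    obtain ⟨z₀, rfl⟩ := hg₀s b
    exact ⟨z₀, hb, key z z₀ hb hab⟩
  · intro z₀ hz₀
    obtain ⟨a, ha, hab⟩ := hA₀ _ hz₀
    obtain ⟨z, rfl⟩ := hgs a
    exact ⟨z, ha, by rw [dist_comm]; exact key z z₀ hz₀ hab⟩

/-- Preimages of compact sets under continuous strongly monotone maps are compact. -/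
theorem isCompact_preimage_of_strongly_monotone [FiniteDimensional ℝ E] {g : E → E} {c : ℝ}
    (hc : 0 < c) (hgc : Continuous g)
    (hg : ∀ x y, c * ‖x - y‖ ^ 2 ≤ inner ℝ (g x - g y) (x - y)) {A : Set E} (hA : IsCompact A) :
    IsCompact (g ⁻¹' A) := by
  have : ProperSpace E := FiniteDimensional.proper ℝ E
  have hanti : AntilipschitzWith (Real.toNNReal c⁻¹) g :=
    AntilipschitzWith.of_le_mul_dist fun x y => by
      rw [Real.coe_toNNReal _ (by positivity), dist_eq_norm, dist_eq_norm, ← div_eq_inv_mul,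
        le_div_iff₀ hc, mul_comm]
      exact mul_norm_sub_le_of_strongly_monotone hg x y
  exact Metric.isCompact_of_isClosed_isBounded (hA.isClosed.preimage hgc)
    (hanti.isBounded_preimage hA.isBounded)

end MonotoneOperators

/-- Points of a nonempty compact set have partners in another one within the Hausdorff distance. -/
theorem exists_dist_le_hausdorffDist {E : Type*} [MetricSpace E] {A B : Set E}
    (hA : A.Nonempty ∧ IsCompact A) (hB : B.Nonempty ∧ IsCompact B) {a : E} (ha : a ∈ A) :
    ∃ b ∈ B, dist a b ≤ Metric.hausdorffDist A B := by
  obtain ⟨b, hb, hab⟩ := hB.2.exists_infDist_eq_dist hB.1 a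
  exact ⟨b, hb, hab ▸ Metric.infDist_le_hausdorffDist_of_mem ha
    (Metric.hausdorffEDist_ne_top_of_nonempty_of_bounded hA.1 hB.1 hA.2.isBounded
      hB.2.isBounded)⟩

/-! ### The implicit step as a preimage -/

section EulerStep

variable {d : ℕ}

theorem eulerStep_eq_preimage (f : ℝ → EuclideanSpace ℝ (Fin d) → EuclideanSpace ℝ (Fin d))
    (M : ℝ → EuclideanSpace ℝ (Fin d) → Set (EuclideanSpace ℝ (Fin d)))
    (t : ℝ) (x : EuclideanSpace ℝ (Fin d)) (h : ℝ) :
    eulerStep f M t x h =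
      (fun z => z - h • f (t + h) z) ⁻¹' ((fun m => x + h • m) '' M t x) := by
  ext z
  simp only [eulerStep, mem_ofPred_eq, mem_preimage, mem_image]
  refine exists_congr fun m => and_congr_right fun _ => ?_
  rw [eq_sub_iff_add_eq, eq_comm, add_right_comm]

/-- Subtracting a small multiple of a one-sided Lipschitz map from the identity gives a strongly
monotone map. -/
theorem strongly_monotone_sub_smul {E : Type*} [NormedAddCommGroup E] [InnerProductSpace ℝ E]
    {φ : E → E} {l h : ℝ} (hh : 0 ≤ h)
    (hφ : ∀ x y, inner ℝ (φ x - φ y) (x - y) ≤ l * ‖x - y‖ ^ 2) (x y : E) :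
    (1 - l * h) * ‖x - y‖ ^ 2 ≤ inner ℝ ((x - h • φ x) - (y - h • φ y)) (x - y) := by
  have h1 : (x - h • φ x) - (y - h • φ y) = (x - y) - h • (φ x - φ y) := by
    rw [smul_sub]; abel
  rw [h1, inner_sub_left, real_inner_smul_left, real_inner_self_eq_norm_sq]
  nlinarith [mul_le_mul_of_nonneg_left (hφ x y) hh]

theorem eulerStep_zero {f : ℝ → EuclideanSpace ℝ (Fin d) → EuclideanSpace ℝ (Fin d)}
    {M : ℝ → EuclideanSpace ℝ (Fin d) → Set (EuclideanSpace ℝ (Fin d))}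
    {t : ℝ} {x : EuclideanSpace ℝ (Fin d)} (hM : (M t x).Nonempty) :
    eulerStep f M t x 0 = {x} := by
  obtain ⟨m, hm⟩ := hM
  ext z
  simp only [eulerStep, mem_ofPred_eq, zero_smul, add_zero, mem_singleton_iff]
  exact ⟨fun ⟨_, _, h⟩ => h, fun h => ⟨m, hm, h⟩⟩

/-- The splitting pairs `h - h₀` with `m₀` alone, so only the values of `M` at the fixed base point
need a norm bound. -/
theorem norm_add_smul_sub_add_smul_le {E : Type*} [NormedAddCommGroup E] [NormedSpace ℝ E]
    {h : ℝ} (hh : 0 ≤ h) (h₀ : ℝ) (x x₀ m m₀ : E) :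
    ‖(x + h • m) - (x₀ + h₀ • m₀)‖ ≤ ‖x - x₀‖ + h * ‖m - m₀‖ + |h - h₀| * ‖m₀‖ := by
  have : (x + h • m) - (x₀ + h₀ • m₀) = (x - x₀) + h • (m - m₀) + (h - h₀) • m₀ := by
    rw [smul_sub, sub_smul]; abel
  rw [this]
  refine (norm_add₃_le).trans ?_
  rw [norm_smul, norm_smul, Real.norm_of_nonneg hh, Real.norm_eq_abs]

end EulerStep

/-! ### Continuity and Lipschitz estimates for the scheme -/

theorem theorem13 (d : ℕ) (T : ℝ)
    (f : ℝ → EuclideanSpace ℝ (Fin d) → EuclideanSpace ℝ (Fin d))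
    (M : ℝ → EuclideanSpace ℝ (Fin d) → Set (EuclideanSpace ℝ (Fin d)))
    (lf LM : ℝ → ℝ)
    -- `f` is continuous on `[0,T] × ℝ^d` and `f t` is one-sided Lipschitz with constant `lf t`
    (hf : ContinuousOn (fun p : ℝ × EuclideanSpace ℝ (Fin d) => f p.1 p.2) (Icc 0 T ×ˢ univ))
    (hlf : ContinuousOn lf (Icc 0 T))
    (hfOSL : ∀ t ∈ Icc 0 T, ∀ x x' : EuclideanSpace ℝ (Fin d),
      inner ℝ (f t x - f t x') (x - x') ≤ lf t * ‖x - x'‖ ^ 2)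
    -- `M` has convex values, nonempty compact values, and is continuous on `[0,T] × ℝ^d`;
    -- `M t` is Lipschitz with constant `LM t`
    (hMconv : ∀ t ∈ Icc 0 T, ∀ x, Convex ℝ (M t x))
    (hM : HausdorffContinuousOn
      (fun p : ℝ × EuclideanSpace ℝ (Fin d) => M p.1 p.2) (Icc 0 T ×ˢ univ))
    (hLM : ContinuousOn LM (Icc 0 T))
    (hLM0 : ∀ t ∈ Icc 0 T, 0 ≤ LM t)
    (hMLip : ∀ t ∈ Icc 0 T, ∀ x x' : EuclideanSpace ℝ (Fin d),
      Metric.hausdorffDist (M t x) (M t x') ≤ LM t * ‖x - x'‖) :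
    -- joint continuity on `D`, including that the values are nonempty and compact
    HausdorffContinuousOn
      (fun p : ℝ × EuclideanSpace ℝ (Fin d) × ℝ => eulerStep f M p.1 p.2.1 p.2.2)
      (eulerDomain T lf) ∧
    -- Lipschitz continuity in `x`
    (∀ (t h : ℝ) (x x' : EuclideanSpace ℝ (Fin d)),
      (t, x, h) ∈ eulerDomain T lf → (t, x', h) ∈ eulerDomain T lf →
      Metric.hausdorffDist (eulerStep f M t x h) (eulerStep f M t x' h) ≤
        (1 + h * LM t) / (1 - lf (t + h) * h) * ‖x - x'‖) ∧
    -- `Φ(t, x; 0) = {x}`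
    (∀ t ∈ Icc 0 T, ∀ x : EuclideanSpace ℝ (Fin d), eulerStep f M t x 0 = {x}) := by
  have hMne : ∀ t ∈ Icc 0 T, ∀ x, (M t x).Nonempty ∧ IsCompact (M t x) :=
    fun t ht x => hM.1 (t, x) ⟨ht, mem_univ _⟩
  have hmem : ∀ p ∈ eulerDomain (d := d) T lf, p.1 ∈ Icc 0 T ∧ p.1 + p.2.2 ∈ Icc 0 T ∧ 0 ≤ p.2.2 ∧
      0 < 1 - lf (p.1 + p.2.2) * p.2.2 := fun p hp =>
    ⟨hp.1, ⟨add_nonneg hp.1.1 hp.2.1, hp.2.2.1⟩, hp.2.1, by linarith [hp.2.2.2]⟩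
  have hmono : ∀ p ∈ eulerDomain (d := d) T lf, ∀ z z' : EuclideanSpace ℝ (Fin d),
      (1 - lf (p.1 + p.2.2) * p.2.2) * ‖z - z'‖ ^ 2 ≤
        inner ℝ ((z - p.2.2 • f (p.1 + p.2.2) z) - (z' - p.2.2 • f (p.1 + p.2.2) z')) (z - z') :=
    fun p hp => strongly_monotone_sub_smul (hmem p hp).2.2.1 (hfOSL _ (hmem p hp).2.1)
  have hcont : ∀ p ∈ eulerDomain (d := d) T lf,
      Continuous fun z => z - p.2.2 • f (p.1 + p.2.2) z := fun p hp =>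
    have hfp : Continuous fun z => f (p.1 + p.2.2) z :=
      hf.comp_continuous (by fun_prop : Continuous fun z => (p.1 + p.2.2, z))
        fun z => ⟨(hmem p hp).2.1, mem_univ _⟩
    continuous_id.sub (hfp.const_smul p.2.2)
  have hsurj : ∀ p ∈ eulerDomain (d := d) T lf,
      Function.Surjective fun z => z - p.2.2 • f (p.1 + p.2.2) z := fun p hp =>
    surjective_of_strongly_monotone (hmem p hp).2.2.2 (hcont p hp) (hmono p hp)
  have hval : ∀ p ∈ eulerDomain (d := d) T lf, (eulerStep f M p.1 p.2.1 p.2.2).Nonempty ∧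
      IsCompact (eulerStep f M p.1 p.2.1 p.2.2) := by
    intro p hp
    obtain ⟨hne, hcpt⟩ := hMne p.1 (hmem p hp).1 p.2.1
    rw [eulerStep_eq_preimage]
    exact ⟨(hne.image _).preimage (hsurj p hp),
      isCompact_preimage_of_strongly_monotone (hmem p hp).2.2.2 (hcont p hp) (hmono p hp)
        (hcpt.image (by fun_prop))⟩
  -- two steps, compared at the points of the second
  have hdist : ∀ p ∈ eulerDomain (d := d) T lf, ∀ q ∈ eulerDomain (d := d) T lf, ∀ B ε : ℝ, 0 ≤ ε →
      (∀ m ∈ M p.1 p.2.1, ‖m‖ ≤ B) → 0 ≤ B →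
      (∀ z ∈ eulerStep f M p.1 p.2.1 p.2.2,
        ‖q.2.2 • f (q.1 + q.2.2) z - p.2.2 • f (p.1 + p.2.2) z‖ ≤ ε) →
      Metric.hausdorffDist (eulerStep f M q.1 q.2.1 q.2.2) (eulerStep f M p.1 p.2.1 p.2.2) ≤
        (‖q.2.1 - p.2.1‖ + q.2.2 * Metric.hausdorffDist (M q.1 q.2.1) (M p.1 p.2.1) +
          |q.2.2 - p.2.2| * B + ε) / (1 - lf (q.1 + q.2.2) * q.2.2) := by
    intro p hp q hq B ε hε hB hB0 hfe
    have hMp := hMne p.1 (hmem p hp).1 p.2.1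
    have hMq := hMne q.1 (hmem q hq).1 q.2.1
    have hq0 := (hmem q hq).2.2.1
    have hH : 0 ≤ Metric.hausdorffDist (M q.1 q.2.1) (M p.1 p.2.1) := Metric.hausdorffDist_nonneg
    rw [eulerStep_eq_preimage f M p.1] at hfe ⊢
    rw [eulerStep_eq_preimage f M q.1]
    refine hausdorffDist_preimage_le (hmem q hq).2.2.2 (hmono q hq) (hsurj q hq) (hsurj p hp)
      (by positivity) hε ?_ ?_ ?_
    · rintro _ ⟨m, hm, rfl⟩
      obtain ⟨m₀, hm₀, hmm⟩ := exists_dist_le_hausdorffDist hMq hMp hm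
      rw [dist_eq_norm] at hmm
      refine ⟨_, ⟨m₀, hm₀, rfl⟩, (norm_add_smul_sub_add_smul_le hq0 _ _ _ _ _).trans ?_⟩
      exact add_le_add (add_le_add le_rfl (mul_le_mul_of_nonneg_left hmm hq0))
        (mul_le_mul_of_nonneg_left (hB m₀ hm₀) (abs_nonneg _))
    · rintro _ ⟨m₀, hm₀, rfl⟩
      obtain ⟨m, hm, hmm⟩ := exists_dist_le_hausdorffDist hMp hMq hm₀
      rw [dist_comm, dist_eq_norm, Metric.hausdorffDist_comm] at hmm
      refine ⟨_, ⟨m, hm, rfl⟩, (norm_add_smul_sub_add_smul_le hq0 _ _ _ _ _).trans ?_⟩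
      exact add_le_add (add_le_add le_rfl (mul_le_mul_of_nonneg_left hmm hq0))
        (mul_le_mul_of_nonneg_left (hB m₀ hm₀) (abs_nonneg _))
    · intro z hz
      rw [sub_sub_sub_cancel_left, norm_sub_rev]
      exact hfe z hz
  refine ⟨⟨hval, fun p hp => ?_⟩, fun t h x x' hx hx' => ?_, fun t ht x =>
    eulerStep_zero (hMne t ht x).1⟩
  · obtain ⟨B, hB0, hB⟩ := (hMne p.1 (hmem p hp).1 p.2.1).2.isBounded.exists_pos_norm_le
    have hsum : ContinuousOn (fun q : ℝ × EuclideanSpace ℝ (Fin d) × ℝ => lf (q.1 + q.2.2))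
        (eulerDomain T lf) :=
      hlf.comp (by fun_prop) fun q hq => (hmem q hq).2.1
    have hstep : Tendsto (fun q : ℝ × EuclideanSpace ℝ (Fin d) × ℝ =>
        1 - lf (q.1 + q.2.2) * q.2.2) (𝓝[eulerDomain T lf] p)
        (𝓝 (1 - lf (p.1 + p.2.2) * p.2.2)) :=
      (continuousOn_const.sub (hsum.mul (by fun_prop))) p hp
    have hMlim : Tendsto (fun q : ℝ × EuclideanSpace ℝ (Fin d) × ℝ =>
        Metric.hausdorffDist (M q.1 q.2.1) (M p.1 p.2.1)) (𝓝[eulerDomain T lf] p) (𝓝 0) := by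
      refine (hM.2 (p.1, p.2.1) ⟨(hmem p hp).1, mem_univ _⟩).comp
        (f := fun q : ℝ × EuclideanSpace ℝ (Fin d) × ℝ => (q.1, q.2.1)) ?_
      refine tendsto_nhdsWithin_iff.2 ⟨Continuous.continuousWithinAt (by fun_prop), ?_⟩
      filter_upwards [self_mem_nhdsWithin] with q hq using ⟨(hmem q hq).1, mem_univ _⟩
    have hx : Tendsto (fun q : ℝ × EuclideanSpace ℝ (Fin d) × ℝ => ‖q.2.1 - p.2.1‖)
        (𝓝[eulerDomain T lf] p) (𝓝 ‖p.2.1 - p.2.1‖) :=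
      Continuous.continuousWithinAt (f := fun q : ℝ × EuclideanSpace ℝ (Fin d) × ℝ =>
        ‖q.2.1 - p.2.1‖) (by fun_prop)
    have hh : Tendsto (fun q : ℝ × EuclideanSpace ℝ (Fin d) × ℝ => q.2.2)
        (𝓝[eulerDomain T lf] p) (𝓝 p.2.2) :=
      Continuous.continuousWithinAt (f := fun q : ℝ × EuclideanSpace ℝ (Fin d) × ℝ => q.2.2)
        (by fun_prop)
    have hc := (hmem p hp).2.2.2
    set c := 1 - lf (p.1 + p.2.2) * p.2.2 with hcdef
    -- The share `ε * c / 2` reserved for the change of `f` becomes `ε / 2` after division by the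
    -- limit constant `c`; the other terms vanish.
    have hbound : ∀ ε > 0, Tendsto (fun q : ℝ × EuclideanSpace ℝ (Fin d) × ℝ =>
        (‖q.2.1 - p.2.1‖ + q.2.2 * Metric.hausdorffDist (M q.1 q.2.1) (M p.1 p.2.1) +
          |q.2.2 - p.2.2| * B + ε * c / 2) / (1 - lf (q.1 + q.2.2) * q.2.2))
        (𝓝[eulerDomain T lf] p) (𝓝 (ε / 2)) := by
      intro ε hε
      have := (((hx.add (hh.mul hMlim)).add (((hh.sub_const p.2.2).abs).mul_const B)).add_const
        (ε * c / 2)).div hstep hc.ne'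
      refine this.trans (le_of_eq ?_)
      congr 1
      rw [sub_self, sub_self, norm_zero, abs_zero]
      field_simp
      ring
    rw [Metric.tendsto_nhds]
    intro ε hε
    have hfc : ContinuousOn (Function.uncurry
        fun (q : ℝ × EuclideanSpace ℝ (Fin d) × ℝ) z => q.2.2 • f (q.1 + q.2.2) z)
        (eulerDomain T lf ×ˢ eulerStep f M p.1 p.2.1 p.2.2) := by
      have hr : Continuous fun r : (ℝ × EuclideanSpace ℝ (Fin d) × ℝ) ×
          EuclideanSpace ℝ (Fin d) => r.1.2.2 := by fun_prop
      exact hr.continuousOn.smul <| hf.comp (f := fun r : (ℝ × EuclideanSpace ℝ (Fin d) × ℝ) × EuclideanSpace ℝ (Fin d) =>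
        (r.1.1 + r.1.2.2, r.2)) (Continuous.continuousOn (by fun_prop)) fun r hr => ⟨(hmem _ hr.1).2.1, mem_univ _⟩
    -- Compactness of the value at `p` makes the change of `h • f (t + h) z` small uniformly in `z`.
    obtain ⟨v, hv, hvf⟩ := (hval p hp).2.mem_uniformity_of_prod hfc hp
      (Metric.dist_mem_uniformity (by positivity : 0 < ε * c / 2))
    filter_upwards [hv, self_mem_nhdsWithin,
      (hbound ε hε).eventually (gt_mem_nhds (half_lt_self hε))] with q hqv hq hqε
    rw [Real.dist_0_eq_abs, abs_of_nonneg Metric.hausdorffDist_nonneg]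
    refine (hdist p hp q hq B (ε * c / 2) (by positivity) hB hB0.le
      fun z hz => ?_).trans_lt hqε
    rw [← dist_eq_norm]
    exact (hvf q hqv z hz).le
  · obtain ⟨B, hB0, hB⟩ := (hMne t (hmem _ hx').1 x').2.isBounded.exists_pos_norm_le
    -- Here `t` and `h` agree, so the map does not change (`ε = 0`) and the factor of `B` is `|h -
    -- h| = 0`.
    have h1 := hdist _ hx' _ hx B 0 le_rfl hB hB0.le (by simp)
    refine h1.trans ?_
    have hh := (hmem _ hx).2.2.1
    have hc := (hmem _ hx).2.2.2
    have hL := mul_le_mul_of_nonneg_left (hMLip t (hmem _ hx).1 x x') hh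
    dsimp only at hh hc hL ⊢
    rw [div_mul_eq_mul_div]
    gcongr
    simp only [sub_self, abs_zero, zero_mul, add_zero]
    linarith
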